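/- Let $\sigma=\mathrm{Prop}\cup\{R_i: i\in I\}$ be a modal signature with a finite set $\mathrm{Prop}$ of proposition letters (unary predicates) and finitely many actions (binary predicates) $R_i$. A $\sigma$-LTS $M_a$ is a $\sigma$-structure $M$ with one distinguished element $a$; it is finite if $\mathrm{dom}(M)$ is finite. Formulas of $\mathrm{ML}_{\#}^{G}$ are given by $$\varphi ::= \top \mid p \mid \varphi\wedge\varphi \mid \varphi\vee\varphi \mid \neg\varphi \mid \Diamond_i\varphi \mid \Box_i\varphi \mid \Diamond_i^{\ge k}\varphi\ (k\ge 1) \mid \mathrm{E}^{\ge k}\varphi\ (k\ge 0),$$ with $p\in\mathrm{Prop}$ and $i\in I$, and the usual semantics of the Boolean connectives and of $\Diamond_i,\Box_i$; moreover $M_a\models\Diamond_i^{\ge k}\varphi$ iff at least $k$ elements $b$ with $R_i^M(a,b)$ satisfy $M_b\models\varphi$, and $M_a\models\mathrm{E}^{\ge k}\varphi$ iff at least $k$ elements $b\in\mathrm{dom}(M)$ satisfy $M_b\models\varphi$. Write $M_a\equiv^{\sigma}_{\mathrm{ML}_{\#}^{G}}N_b$ if $M_a$ and $N_b$ satisfy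 the same formulas of $\mathrm{ML}_{\#}^{G}$. A directed path from $m$ to $n$ is a (possibly empty, if $m=n$) sequence of binary facts $R_{i_1}(b_0,b_1),R_{i_2}(b_1,b_2),\dots,R_{i_k}(b_{k-1},b_k)$ with $b_0=m$, $b_k=n$; two paths are equal if they consist of the same facts (including the actions) in the same order. A $\sigma$-LTS $M_a$ is a $\sigma$-tree if for every $m\in\mathrm{dom}(M)$ there is exactly one directed path from $a$ to $m$. A $\sigma$-forest is (up to isomorphism) a disjoint union of a finite family of $\sigma$-trees, with the root of one of them as distinguished element. Let $\mathcal F_\sigma$ be the class of finite $\sigma$-forests. Homomorphisms preserve all facts and the distinguished element, and $\hom_{\mathbb N}(T_c,M_a)$ is the number of homomorphisms from $T_c$ to $M_a$. **Theorem.** Let $M_a$ and $N_b$ be finite $\sigma$-LTSs. Then $$M_a\equiv^{\sigma}_{\mathrm{ML}_{\#}^{G}}N_b \quad\Longleftrightarrow\quad \hom_{\mathbb N}(T_c,M_a)=\hom_{\mathbb N}(T_c,N_b)\ \text{ for every } T_c\in\mathcal F_\sigma .$$ -/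

import Mathlib

universe u v w w₁ w₂ t

namespace ModalHom

/-- A labeled transition system (with one distinguished state `pt`) over the modal signature
whose proposition letters are the elements of `P` and whose actions are `R i`, for `i : I`. -/
structure LTS (P : Type u) (I : Type v) where
  /-- the set of states -/
  carrier : Type w
  /-- the interpretation of the proposition letters -/
  prop : P → carrier → Prop
  /-- the interpretation of the actions -/
  rel : I → carrier → carrier → Prop
  /-- the distinguished state -/
  pt : carrier

variable {P : Type u} {I : Type v}

namespace LTS

/-- `f` maps the distinguished state to the distinguished state and preserves all facts. -/
structure IsHom (M : LTS.{u, v, w₁} P I) (N : LTS.{u, v, w₂} P I)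
    (f : M.carrier → N.carrier) : Prop where
  map_pt : f M.pt = N.pt
  map_prop : ∀ p x, M.prop p x → N.prop p (f x)
  map_rel : ∀ i x y, M.rel i x y → N.rel i (f x) (f y)

/-- The collection of homomorphisms from `M` to `N`. -/
def Hom (M : LTS.{u, v, w₁} P I) (N : LTS.{u, v, w₂} P I) : Type (max w₁ w₂) :=
  {f : M.carrier → N.carrier // M.IsHom N f}

/-- `M` and `N` are isomorphic: some bijective homomorphism has a homomorphism as inverse. -/
def IsIso (M : LTS.{u, v, w₁} P I) (N : LTS.{u, v, w₂} P I) : Prop :=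
  ∃ e : M.carrier ≃ N.carrier, M.IsHom N e ∧ N.IsHom M e.symm

/-- Between finite systems there are finitely many homomorphisms, so they can be counted. -/
instance (M : LTS.{u, v, w₁} P I) (N : LTS.{u, v, w₂} P I) [Finite M.carrier]
    [Finite N.carrier] : Finite (M.Hom N) :=
  inferInstanceAs (Finite {f : M.carrier → N.carrier // M.IsHom N f})

/-- The homomorphism count over the semiring `S`: the sum of as many copies of `1 : S` as there
are homomorphisms from `M` to `N` (meaningful when there are finitely many of these). -/
noncomputable def homCount (S : Type*) [Semiring S] (M : LTS.{u, v, w₁} P I)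
    (N : LTS.{u, v, w₂} P I) : S :=
  ((Nat.card (M.Hom N) : ℕ) : S)

/-- The left homomorphism vector of `M` over `S` restricted to the class `C`. -/
noncomputable def leftProfile (S : Type*) [Semiring S] (C : Set (LTS.{u, v, t} P I))
    (M : LTS.{u, v, w} P I) : C → S :=
  fun T => homCount S T.1 M

/-- The binary facts of `M`: an arrow from `x` to `y` is an action that holds of `(x, y)`.
A directed path is then a `Quiver.Path`, that is, a (possibly empty) sequence of composable
binary facts. -/
instance quiver (M : LTS.{u, v, w} P I) : Quiver M.carrier where
  Hom x y := {i : I // M.rel i x y}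

/-- `M` is a tree: there is a unique directed path from the distinguished state to each state. -/
def IsTree (M : LTS.{u, v, w} P I) : Prop :=
  ∀ m : M.carrier, Nonempty (Unique (Quiver.Path M.pt m))

/-- The disjoint union of a family of systems, with the distinguished state of the `j₀`-th. -/
def disjointUnion {J : Type} (F : J → LTS.{u, v, w} P I) (j₀ : J) : LTS.{u, v, w} P I where
  carrier := Σ j, (F j).carrier
  prop p x := (F x.1).prop p x.2
  rel i x y := ∃ (j : J) (a b : (F j).carrier), x = ⟨j, a⟩ ∧ y = ⟨j, b⟩ ∧ (F j).rel i a b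
  pt := ⟨j₀, (F j₀).pt⟩

/-- `M` is a forest: up to isomorphism, it is a disjoint union of finitely many trees, whose
distinguished state is the root of one of them. -/
def IsForest (M : LTS.{u, v, w} P I) : Prop :=
  ∃ (J : Type) (_ : Finite J) (F : J → LTS.{u, v, w} P I) (j₀ : J),
    (∀ j, (F j).IsTree) ∧ M.IsIso (disjointUnion F j₀)

end LTS

/-- The class of finite forests. -/
def finiteForests (P : Type u) (I : Type v) : Set (LTS.{u, v, t} P I) :=
  {T | Finite T.carrier ∧ T.IsForest}

/-- Formulas of graded modal logic with the counting global modalities. -/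
inductive Formula (P : Type u) (I : Type v) : Type (max u v)
  | top : Formula P I
  | letter (p : P) : Formula P I
  | and (φ ψ : Formula P I) : Formula P I
  | or (φ ψ : Formula P I) : Formula P I
  | neg (φ : Formula P I) : Formula P I
  | dia (i : I) (φ : Formula P I) : Formula P I
  | box (i : I) (φ : Formula P I) : Formula P I
  /-- at least `k` many `R i`-successors satisfy `φ` -/
  | gradedDia (i : I) (k : ℕ+) (φ : Formula P I) : Formula P I
  /-- at least `k` many states satisfy `φ` -/
  | global (k : ℕ) (φ : Formula P I) : Formula P I

/-- Truth of a formula at the state `x` of `M` (the distinguished state of `M` plays no role). -/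
def Sat (M : LTS.{u, v, w} P I) : M.carrier → Formula P I → Prop
  | _, .top => True
  | x, .letter p => M.prop p x
  | x, .and φ ψ => Sat M x φ ∧ Sat M x ψ
  | x, .or φ ψ => Sat M x φ ∨ Sat M x ψ
  | x, .neg φ => ¬ Sat M x φ
  | x, .dia i φ => ∃ y, M.rel i x y ∧ Sat M y φ
  | x, .box i φ => ∀ y, M.rel i x y → Sat M y φ
  | x, .gradedDia i k φ => ((k : ℕ) : ℕ∞) ≤ {y | M.rel i x y ∧ Sat M y φ}.encard
  | _, .global k φ => (k : ℕ∞) ≤ {y | Sat M y φ}.encard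

/-- `M` and `N` satisfy the same formulas at their distinguished states. -/
def Equivalent (M : LTS.{u, v, w₁} P I) (N : LTS.{u, v, w₂} P I) : Prop :=
  ∀ φ : Formula P I, Sat M M.pt φ ↔ Sat N N.pt φ

end ModalHom

/-! Moving the root over the states of `M`, a finite tree `T` gives a function x ↦ hom(T, M_x). Such
functions arise from letter indicators by products and sums over successors. A forest count is the
value of one such function at the distinguished state times, for each other component, the sum of
such a function over all states.

From equivalence to counts: on the states of `M` and `N` together, consider functions constant on
classes of states satisfying the same formulas. By finiteness their level sets are definable, so
graded diamonds count the successors with a given value, and successor sums stay in this class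
(`Invariant.succSum`). Hence tree counts are invariant, and the global modalities make their total
sums over `M` and `N` agree.

From counts to equivalence: the rational span of the tree counts on both systems is an algebra
closed under successor sums and, by Lagrange interpolation, under composition with any function ℚ →
ℚ (`comp_mem_treeSpan`). So it contains the indicator of every formula (`truthInd_mem_treeSpan`):
successor sums of an indicator count successors, and a threshold is a composition. Single trees give
equal values at the two distinguished states throughout the span; a tree beside a one-point tree
gives equal total sums, which settles the global modalities. -/

namespace ModalHom

variable {P : Type u} {I : Type v}

/-! ### Trees described locally by ranks and incoming facts -/

namespace LTS

/-- The system `M` with the distinguished state moved to `x`. -/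
def at' (M : LTS.{u, v, w} P I) (x : M.carrier) : LTS.{u, v, w} P I := { M with pt := x }

/-- The states of `M` are ranked by `d`, and all but the distinguished one have a unique
incoming fact. -/
structure IsRankedTree (M : LTS.{u, v, w} P I) (d : M.carrier → ℕ) : Prop where
  rank_rel : ∀ i x y, M.rel i x y → d y = d x + 1
  not_rel_pt : ∀ i x, ¬ M.rel i x M.pt
  exists_rel : ∀ y, y ≠ M.pt → ∃ i x, M.rel i x y
  rel_unique : ∀ i j x x' y, M.rel i x y → M.rel j x' y → i = j ∧ x = x'

/-- The rank is the length of the unique path; each local condition follows by comparing paths that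
end in a given fact. -/
theorem IsTree.exists_isRankedTree {M : LTS.{u, v, w} P I} (h : M.IsTree) :
    ∃ d, M.IsRankedTree d := by
  have huniq : ∀ {m} (p q : Quiver.Path M.pt m), p = q := fun {m} p q =>
    (h m).elim fun inst => (inst.uniq p).trans (inst.uniq q).symm
  choose π _ using fun m => (h m).elim fun inst => (⟨inst.default, trivial⟩ :
    ∃ _ : Quiver.Path M.pt m, True)
  refine ⟨fun m => (π m).length, ?_, ?_, ?_, ?_⟩
  · intro i x y hxy
    rw [huniq (π y) ((π x).cons ⟨i, hxy⟩), Quiver.Path.length_cons]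
  · intro i x hx
    have := congrArg Quiver.Path.length (huniq Quiver.Path.nil ((π x).cons ⟨i, hx⟩))
    simp at this
  · intro y hy
    cases hp : π y with
    | nil => exact absurd rfl hy
    | cons q e => exact ⟨e.1, _, e.2⟩
  · intro i j x x' y hx hx'
    have := huniq ((π x).cons ⟨i, hx⟩) ((π x').cons ⟨j, hx'⟩)
    have hxx := Quiver.Path.obj_eq_of_cons_eq_cons this
    subst hxx
    have := Quiver.Path.hom_heq_of_cons_eq_cons this
    exact ⟨congrArg Subtype.val (eq_of_heq this), rfl⟩

/-- Walking backwards lowers the rank, so it stops, and only at the root; the walk is forced because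
incoming facts are unique. -/
theorem IsRankedTree.isTree {M : LTS.{u, v, w} P I} {d : M.carrier → ℕ}
    (h : M.IsRankedTree d) : M.IsTree := by
  have hex : ∀ n, ∀ m, d m = n → Nonempty (Quiver.Path M.pt m) := by
    intro n
    induction n with
    | zero =>
      intro m hm
      by_cases hr : m = M.pt
      · subst hr; exact ⟨Quiver.Path.nil⟩
      · obtain ⟨i, x, hx⟩ := h.exists_rel m hr
        have := h.rank_rel i x m hx
        omega
    | succ n ih =>
      intro m hm
      by_cases hr : m = M.pt
      · subst hr; exact ⟨Quiver.Path.nil⟩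
      · obtain ⟨i, x, hx⟩ := h.exists_rel m hr
        have := h.rank_rel i x m hx
        obtain ⟨p⟩ := ih x (by omega)
        exact ⟨p.cons ⟨i, hx⟩⟩
  have huniq : ∀ {m} (p q : Quiver.Path M.pt m), p = q := by
    intro m p
    induction p with
    | nil =>
      intro q
      generalize hm : M.pt = m at q
      cases q with
      | nil => rfl
      | cons q e => subst hm; exact absurd e.2 (h.not_rel_pt _ _)
    | cons p e ih =>
      intro q
      cases q with
      | nil => exact absurd e.2 (h.not_rel_pt _ _)
      | cons q e' =>
        obtain ⟨i, he⟩ := e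
        obtain ⟨j, he'⟩ := e'
        obtain ⟨rfl, rfl⟩ := h.rel_unique _ _ _ _ _ he he'
        rw [ih q]
  exact fun m => (hex _ m rfl).elim fun p => ⟨⟨⟨p⟩, fun q => huniq q p⟩⟩

/-! ### Homomorphisms from disjoint unions -/

theorem homCount_congr_of_isIso {T : LTS.{u, v, w₁} P I} {T' : LTS.{u, v, w₂} P I}
    (h : T.IsIso T') (M : LTS.{u, v, w} P I) : Nat.card (T.Hom M) = Nat.card (T'.Hom M) := by
  obtain ⟨e, he, he'⟩ := h
  refine Nat.card_congr
    { toFun := fun f => ⟨f.1 ∘ e.symm, ?_, ?_, ?_⟩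
      invFun := fun f => ⟨f.1 ∘ e, ?_, ?_, ?_⟩
      left_inv := fun f => Subtype.ext (by funext x; simp)
      right_inv := fun f => Subtype.ext (by funext x; simp) }
  · simpa [he'.map_pt] using f.2.map_pt
  · exact fun p x hx => f.2.map_prop _ _ (he'.map_prop _ _ hx)
  · exact fun i x y hx => f.2.map_rel _ _ _ (he'.map_rel _ _ _ hx)
  · simpa [he.map_pt] using f.2.map_pt
  · exact fun p x hx => f.2.map_prop _ _ (he.map_prop _ _ hx)
  · exact fun i x y hx => f.2.map_rel _ _ _ (he.map_rel _ _ _ hx)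

/-- The index is the image of the distinguished state, so the underlying map determines the whole
pair. -/
theorem sigma_hom_at'_ext {S : LTS.{u, v, w₁} P I} {M : LTS.{u, v, w} P I}
    {g h : Σ y : M.carrier, S.Hom (M.at' y)} (hgh : g.2.1 = h.2.1) : g = h := by
  obtain ⟨y, k, hk⟩ := g
  obtain ⟨z, l, hl⟩ := h
  obtain rfl : k = l := hgh
  obtain rfl : y = z := hk.map_pt.symm.trans hl.map_pt
  rfl

/-- Homomorphisms from a disjoint union are families of maps, all but one of which
can send the root to any state. -/
def disjointUnionHomEquiv {J : Type} [DecidableEq J] (F : J → LTS.{u, v, w₁} P I) (j₀ : J)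
    (M : LTS.{u, v, w} P I) :
    (disjointUnion F j₀).Hom M ≃
      ((F j₀).Hom M × ∀ j : {j // j ≠ j₀}, Σ y : M.carrier, (F j).Hom (M.at' y)) where
  toFun f := ⟨⟨fun x => f.1 ⟨j₀, x⟩, f.2.map_pt, fun p x h => f.2.map_prop p ⟨j₀, x⟩ h,
      fun i x y h => f.2.map_rel i ⟨j₀, x⟩ ⟨j₀, y⟩ ⟨j₀, x, y, rfl, rfl, h⟩⟩,
    fun j => ⟨f.1 ⟨j, (F j).pt⟩, fun x => f.1 ⟨j, x⟩, rfl,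
      fun p x h => f.2.map_prop p ⟨j, x⟩ h,
      fun i x y h => f.2.map_rel i ⟨j, x⟩ ⟨j, y⟩ ⟨j, x, y, rfl, rfl, h⟩⟩⟩
  invFun g := ⟨fun z => if h : z.1 = j₀ then g.1.1 (h ▸ z.2) else (g.2 ⟨z.1, h⟩).2.1 z.2, by
      simpa [disjointUnion] using g.1.2.map_pt, by
      rintro p ⟨j, x⟩ hx
      by_cases h : j = j₀
      · subst h; simpa using g.1.2.map_prop p x hx
      · simpa [h, at'] using (g.2 ⟨j, h⟩).2.2.map_prop p x hx, by
      rintro i _ _ ⟨j, x, y, rfl, rfl, hx⟩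
      by_cases h : j = j₀
      · subst h; simpa using g.1.2.map_rel i x y hx
      · simpa [h, at'] using (g.2 ⟨j, h⟩).2.2.map_rel i x y hx⟩
  left_inv f := by
    refine Subtype.ext (funext ?_)
    rintro ⟨j, x⟩
    by_cases h : j = j₀
    · subst h; simp
    · simp [h]
  right_inv g := by
    obtain ⟨g₀, g⟩ := g
    refine Prod.ext (Subtype.ext ?_) (funext fun j => ?_)
    · simp
    · refine (sigma_hom_at'_ext ?_)
      funext x
      simp [j.2]
      rfl

theorem card_hom_disjointUnion {J : Type} [Fintype J] [DecidableEq J]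
    (F : J → LTS.{u, v, w₁} P I) [∀ j, Finite (F j).carrier] (j₀ : J)
    (M : LTS.{u, v, w} P I) [Fintype M.carrier] :
    Nat.card ((disjointUnion F j₀).Hom M) =
      Nat.card ((F j₀).Hom M) *
        ∏ j : {j // j ≠ j₀}, ∑ y : M.carrier, Nat.card ((F j).Hom (M.at' y)) := by
  have (y : M.carrier) : Finite (M.at' y).carrier := inferInstanceAs (Finite M.carrier)
  rw [Nat.card_congr (disjointUnionHomEquiv F j₀ M), Nat.card_prod, Nat.card_pi]
  simp only [Nat.card_sigma]

/-! ### Weighted counts on trees by removing leaves -/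

open Classical in
/-- The sum of `f` over the `R`-successors of `x`. -/
noncomputable def succSum {X : Type w} [Fintype X] (R : X → X → Prop) (f : X → ℕ) (x : X) : ℕ :=
  ∑ y, if R x y then f y else 0

section WeightedCount

variable {X : Type w} [Fintype X] (R : I → X → X → Prop)

open Classical in
/-- The weighted number of maps `f` from the rooted tree with nodes `T`, parent map `par` and
actions `act` which send the root to `x` and preserve all edges. -/
noncomputable def weightedCount {T : Type t} [Fintype T] (r : T) (par : T → T) (act : T → I)
    (W : T → X → ℕ) (x : X) : ℕ :=
  ∑ f : T → X, (if f r = x then 1 else 0) *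
    ∏ m, (if m = r ∨ R (act m) (f (par m)) (f m) then W m (f m) else 0)

open Classical in
theorem weightedCount_of_subsingleton {T : Type t} [Fintype T] [Subsingleton T] (r : T)
    (par : T → T) (act : T → I) (W : T → X → ℕ) :
    weightedCount R r par act W = W r := by
  funext x
  have : Unique T := ⟨⟨r⟩, fun _ => Subsingleton.elim _ _⟩
  obtain rfl : r = default := Subsingleton.elim _ _
  rw [weightedCount, ← (Equiv.funUnique T X).symm.sum_comp]
  simp

open Classical in
/-- Removing the leaf `l` amounts to changing the weight at its parent. -/
theorem weightedCount_eq_of_leaf {T : Type t} [Fintype T] (r : T) (par : T → T) (act : T → I)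
    (W : T → X → ℕ) (l : T) [Fintype {m // m ≠ l}] (hr : r ≠ l) (hl : ∀ m, m ≠ r → par m ≠ l) :
    weightedCount R r par act W =
      weightedCount R (T := {m // m ≠ l}) ⟨r, hr⟩
        (fun m => if h : par m = l then m else ⟨par m, h⟩) (fun m => act m)
        (fun m y => W m y * if m = par l then succSum (R (act l)) (W l) y else 1) := by
  funext x
  rw [weightedCount, weightedCount, ← (Equiv.funSplitAt l X).symm.sum_comp, Fintype.sum_prod_type,
    Finset.sum_comm]
  refine Finset.sum_congr (Finset.ext (by simp)) fun f _ => ?_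
  have hp : par l ≠ l := hl l hr.symm
  have key (z : X) (m : {m // m ≠ l}) :
      (Equiv.funSplitAt l X).symm (z, f) m = f m := by
    simp [Equiv.funSplitAt, Equiv.piSplitAt, m.2]
  have keyl (z : X) : (Equiv.funSplitAt l X).symm (z, f) l = z := by
    simp [Equiv.funSplitAt, Equiv.piSplitAt]
  have keyr (z : X) := key z ⟨r, hr⟩
  have keyp (z : X) := key z ⟨par l, hp⟩
  simp only at keyr keyp
  -- No edge leaves `l`, so with `f` fixed elsewhere the image `z` of `l` occurs only in the factor
  -- at `l`. Summing over `z` then gives a successor sum at the image of `par l`.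
  have hprod (z : X) : (∏ m, (if m = r ∨ R (act m) ((Equiv.funSplitAt l X).symm (z, f) (par m))
        ((Equiv.funSplitAt l X).symm (z, f) m) then W m ((Equiv.funSplitAt l X).symm (z, f) m)
        else 0)) =
      (if R (act l) (f ⟨par l, hp⟩) z then W l z else 0) *
        ∏ m : {m // m ≠ l}, (if m = ⟨r, hr⟩ ∨
          R (act m) (f (if h : par m = l then m else ⟨par m, h⟩)) (f m) then W m (f m) else 0) := by
    rw [Fintype.prod_eq_mul_prod_subtype_ne _ l, keyl, keyp]
    congr 1
    · simp [hr.symm]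
    · refine Finset.prod_congr (Finset.ext (by simp)) fun m _ => ?_
      rw [key]
      by_cases hm : (m : T) = r
      · have : m = ⟨r, hr⟩ := Subtype.ext hm
        simp [this]
      · have hm' : m ≠ ⟨r, hr⟩ := fun h => hm (congrArg Subtype.val h)
        have := key z ⟨par m, hl m hm⟩
        simp only at this
        simp [hm, hm', hl m hm, this]
  simp only [keyr, hprod]
  rw [← Finset.mul_sum, ← Finset.sum_mul]
  congr 1
  have hsplit (m : {m // m ≠ l}) (c : Prop) [Decidable c] (y : X) (s : ℕ) :
      (if c then W m y * (if (m : T) = par l then s else 1) else 0) =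
        (if c then W m y else 0) * (if m = ⟨par l, hp⟩ then s else 1) := by
    by_cases hc : c <;> simp [hc, Subtype.ext_iff]
  simp only [hsplit]
  rw [Finset.prod_mul_distrib, mul_comm]
  refine congrArg₂ _ (Finset.prod_congr (Finset.ext (by simp)) fun m _ => by congr) ?_
  · rw [Fintype.prod_eq_single (⟨par l, hp⟩ : {m // m ≠ l}), if_pos rfl, succSum]
    exact fun m hm => if_neg hm

end WeightedCount
/-- A relation between functions on two systems that is compatible with products and successor
sums is compatible with weighted counts of maps from trees. -/
theorem weightedCount_induction {X : Type w₁} {Y : Type w₂} [Fintype X] [Fintype Y]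
    (R : I → X → X → Prop) (S : I → Y → Y → Prop) (K : (X → ℕ) → (Y → ℕ) → Prop)
    (hmul : ∀ f g f' g', K f g → K f' g' → K (f * f') (g * g'))
    (hsucc : ∀ i f g, K f g → K (succSum (R i) f) (succSum (S i) g)) (n : ℕ) :
    ∀ {T : Type t} [Fintype T] (r : T) (par : T → T) (act : T → I) (d : T → ℕ)
      (W : T → X → ℕ) (W' : T → Y → ℕ), Fintype.card T = n + 1 →
      (∀ m, m ≠ r → d m = d (par m) + 1) → (∀ m, K (W m) (W' m)) →
      K (weightedCount R r par act W) (weightedCount S r par act W') := by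
  classical
  induction n with
  | zero =>
    intro T _ r par act d W W' hT _ hW
    have : Subsingleton T := Fintype.card_le_one_iff_subsingleton.1 hT.le
    rw [weightedCount_of_subsingleton, weightedCount_of_subsingleton]
    exact hW r
  | succ n ih =>
    intro T _ r par act d W W' hT hd hW
    have : Nontrivial T := Fintype.one_lt_card_iff_nontrivial.1 (by omega)
    -- A non-root node of maximal rank is a leaf, as a child would have larger rank.
    obtain ⟨l, hlr, hl⟩ : ∃ l, l ≠ r ∧ ∀ m, m ≠ r → d m ≤ d l := by
      obtain ⟨a, ha⟩ := exists_ne r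
      obtain ⟨l, hl, hmax⟩ := Finset.exists_max_image (Finset.univ.filter (· ≠ r)) d
        ⟨a, by simpa using ha⟩
      exact ⟨l, by simpa using hl, fun m hm => hmax m (by simpa using hm)⟩
    have hpar : ∀ m, m ≠ r → par m ≠ l := by
      intro m hm h
      have := hd m hm
      have := hl m hm
      rw [h] at *
      omega
    rw [weightedCount_eq_of_leaf R r par act W l hlr.symm hpar,
      weightedCount_eq_of_leaf S r par act W' l hlr.symm hpar]
    refine ih (T := {m // m ≠ l}) _ _ _ (fun m => d m) _ _ ?_ ?_ ?_
    · rw [Fintype.card_subtype_compl, Fintype.card_subtype_eq, hT]; rfl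
    · intro m hm
      have hm' : (m : T) ≠ r := fun h => hm (Subtype.ext h)
      simpa [hpar m hm'] using hd m hm'
    · intro m
      by_cases h : (m : T) = par l
      · simp only [h, if_true]
        exact hmul _ _ _ _ (hW _) (hsucc (act l) _ _ (hW l))
      · simpa only [h, if_false, mul_one] using hW m

open Classical in
/-- The indicator function of the states satisfying all letters that `m` satisfies. -/
noncomputable def labelWeight (T : LTS.{u, v, t} P I) (M : LTS.{u, v, w} P I) (m : T.carrier)
    (x : M.carrier) : ℕ :=
  if ∀ p, T.prop p m → M.prop p x then 1 else 0

/-- Actions take values in `Option I` because the root has no incoming action and `I` may be empty.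
-/
theorem IsTree.exists_parent {T : LTS.{u, v, t} P I} (hT : T.IsTree) :
    ∃ (par : T.carrier → T.carrier) (act : T.carrier → Option I) (d : T.carrier → ℕ),
      (∀ m, m ≠ T.pt → d m = d (par m) + 1) ∧
      ∀ i x y, T.rel i x y ↔ y ≠ T.pt ∧ x = par y ∧ act y = some i := by
  obtain ⟨d, hd⟩ := hT.exists_isRankedTree
  have : ∀ y, ∃ (x : T.carrier) (i : Option I), y ≠ T.pt → ∃ j, i = some j ∧ T.rel j x y := by
    intro y
    by_cases hy : y = T.pt
    · exact ⟨y, none, fun h => absurd hy h⟩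
    · obtain ⟨i, x, hx⟩ := hd.exists_rel y hy
      exact ⟨x, some i, fun _ => ⟨i, rfl, hx⟩⟩
  choose par act h using this
  refine ⟨par, act, d, fun m hm => ?_, fun i x y => ⟨fun hxy => ?_, ?_⟩⟩
  · obtain ⟨j, _, hj⟩ := h m hm
    exact hd.rank_rel _ _ _ hj
  · have hy : y ≠ T.pt := by rintro rfl; exact hd.not_rel_pt _ _ hxy
    obtain ⟨j, hj, hj'⟩ := h y hy
    obtain ⟨rfl, rfl⟩ := hd.rel_unique _ _ _ _ _ hxy hj'
    exact ⟨hy, rfl, hj⟩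
  · rintro ⟨hy, rfl, hi⟩
    obtain ⟨j, hj, hj'⟩ := h y hy
    obtain rfl : j = i := Option.some_injective _ (hj.symm.trans hi)
    exact hj'

/-- Homomorphisms from a tree are counted by a weighted count. -/
theorem card_hom_eq_weightedCount {T : LTS.{u, v, t} P I} [Fintype T.carrier]
    {par : T.carrier → T.carrier} {act : T.carrier → Option I}
    (h : ∀ i x y, T.rel i x y ↔ y ≠ T.pt ∧ x = par y ∧ act y = some i)
    (hact : ∀ m, m ≠ T.pt → act m ≠ none)
    (M : LTS.{u, v, w} P I) [Fintype M.carrier] (x : M.carrier) :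
    Nat.card (T.Hom (M.at' x)) =
      weightedCount (fun i y z => ∃ j ∈ i, M.rel j y z) T.pt par act (labelWeight T M) x := by
  classical
  have hiff (f : T.carrier → M.carrier) : T.IsHom (M.at' x) f ↔ f T.pt = x ∧ ∀ m,
      (m = T.pt ∨ ∃ j ∈ act m, M.rel j (f (par m)) (f m)) ∧
        ∀ p, T.prop p m → M.prop p (f m) := by
    constructor
    · intro hf
      refine ⟨hf.map_pt, fun m => ⟨or_iff_not_imp_left.2 fun hm => ?_, fun p => hf.map_prop p m⟩⟩
      obtain ⟨j, hj⟩ := Option.ne_none_iff_exists'.1 (hact m hm)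
      exact ⟨j, hj, hf.map_rel _ _ _ ((h _ _ _).2 ⟨hm, rfl, hj⟩)⟩
    · rintro ⟨hx, hm⟩
      refine ⟨hx, fun p y => (hm y).2 p, fun i y z hyz => ?_⟩
      obtain ⟨hz, rfl, hi⟩ := (h _ _ _).1 hyz
      obtain ⟨j, hj, hj'⟩ := (hm z).1.resolve_left hz
      obtain rfl : j = i := Option.some_injective _ (hj.symm.trans hi)
      exact hj'
  have hcard : Nat.card (T.Hom (M.at' x)) = Nat.card {f : T.carrier → M.carrier // f T.pt = x ∧ ∀ m,
      (m = T.pt ∨ ∃ j ∈ act m, M.rel j (f (par m)) (f m)) ∧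
        ∀ p, T.prop p m → M.prop p (f m)} :=
    Nat.card_congr (Equiv.subtypeEquivRight hiff)
  rw [hcard, Nat.card_eq_fintype_card, Fintype.card_subtype, Finset.card_filter, weightedCount]
  refine Finset.sum_congr rfl fun f _ => ?_
  by_cases h1 : f T.pt = x
  · by_cases h2 : ∀ m, (m = T.pt ∨ ∃ j ∈ act m, M.rel j (f (par m)) (f m)) ∧
        ∀ p, T.prop p m → M.prop p (f m)
    · rw [if_pos ⟨h1, h2⟩, if_pos h1, one_mul, Finset.prod_eq_one]
      intro m _
      rw [if_pos (h2 m).1, labelWeight, if_pos (h2 m).2]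
    · rw [if_neg fun h => h2 h.2, if_pos h1, one_mul]
      obtain ⟨m, hm⟩ := not_forall.1 h2
      rw [Finset.prod_eq_zero (Finset.mem_univ m)]
      rcases not_and_or.1 hm with hm | hm
      · rw [if_neg hm]
      · rw [labelWeight, if_neg hm, ite_self]
  · rw [if_neg fun h => h1 h.1, if_neg h1, zero_mul]

/-- A relation between functions on two systems that is compatible with indicators of letters,
products and successor sums is compatible with homomorphism counts from trees. -/
theorem IsTree.card_hom_induction {T : LTS.{u, v, t} P I} [Finite T.carrier] (hT : T.IsTree)
    (M : LTS.{u, v, w₁} P I) (N : LTS.{u, v, w₂} P I) [Fintype M.carrier] [Fintype N.carrier]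
    (K : (M.carrier → ℕ) → (N.carrier → ℕ) → Prop)
    (hlabel : ∀ m, K (labelWeight T M m) (labelWeight T N m))
    (hzero : K 0 0)
    (hmul : ∀ f g f' g', K f g → K f' g' → K (f * f') (g * g'))
    (hsucc : ∀ i f g, K f g → K (succSum (M.rel i) f) (succSum (N.rel i) g)) :
    K (fun x => Nat.card (T.Hom (M.at' x))) (fun y => Nat.card (T.Hom (N.at' y))) := by
  have := Fintype.ofFinite T.carrier
  obtain ⟨par, act, d, hd, h⟩ := hT.exists_parent
  have hact : ∀ m, m ≠ T.pt → act m ≠ none := by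
    obtain ⟨e, he⟩ := hT.exists_isRankedTree
    intro m hm hn
    obtain ⟨i, x, hx⟩ := he.exists_rel m hm
    simpa [hn] using ((h _ _ _).1 hx).2.2
  simp only [card_hom_eq_weightedCount h hact]
  have : Nonempty T.carrier := ⟨T.pt⟩
  refine weightedCount_induction _ _ K hmul ?_ (Fintype.card T.carrier - 1) T.pt par act d _ _
    (Nat.sub_add_cancel Fintype.card_pos).symm hd hlabel
  -- The action `none` is the empty relation, so its successor sums vanish; this is the use of
  -- `hzero`.
  rintro (_ | i) f g hfg
  · convert hzero using 1 <;> funext x <;> simp [succSum]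
  · have hM : (fun y z => ∃ j ∈ some i, M.rel j y z) = M.rel i := by funext y z; simp
    have hN : (fun y z => ∃ j ∈ some i, N.rel j y z) = N.rel i := by funext y z; simp
    simp only [hM, hN]
    exact hsucc i f g hfg

end LTS

/-! ### Definability, and equal counts from equivalence -/

/-- Truth of a formula at a state of one of two systems. -/
def SumSat (M : LTS.{u, v, w₁} P I) (N : LTS.{u, v, w₂} P I) :
    M.carrier ⊕ N.carrier → Formula P I → Prop :=
  Sum.elim (Sat M) (Sat N)

/-- The functions `f` and `g` take equal values at states that satisfy the same formulas. -/
def Invariant (M : LTS.{u, v, w₁} P I) (N : LTS.{u, v, w₂} P I) (f : M.carrier → ℕ)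
    (g : N.carrier → ℕ) : Prop :=
  ∀ a b, (∀ φ, SumSat M N a φ ↔ SumSat M N b φ) → Sum.elim f g a = Sum.elim f g b

section

variable {M : LTS.{u, v, w₁} P I} {N : LTS.{u, v, w₂} P I}

theorem sumSat_and (a : M.carrier ⊕ N.carrier) (φ ψ : Formula P I) :
    SumSat M N a (φ.and ψ) ↔ SumSat M N a φ ∧ SumSat M N a ψ := by
  cases a <;> rfl

theorem sumSat_neg (a : M.carrier ⊕ N.carrier) (φ : Formula P I) :
    SumSat M N a φ.neg ↔ ¬ SumSat M N a φ := by
  cases a <;> rfl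

theorem sumSat_top (a : M.carrier ⊕ N.carrier) : SumSat M N a .top := by
  cases a <;> trivial

theorem exists_sumSat_iff_forall {α : Type*} (s : Finset α) (g : α → Formula P I) :
    ∃ φ, ∀ a : M.carrier ⊕ N.carrier, SumSat M N a φ ↔ ∀ i ∈ s, SumSat M N a (g i) := by
  classical
  induction s using Finset.induction_on with
  | empty => exact ⟨.top, fun a => by simp [sumSat_top]⟩
  | insert i s _ ih =>
    obtain ⟨φ, hφ⟩ := ih
    exact ⟨(g i).and φ, fun a => by simp [sumSat_and, hφ]⟩

/-- A set of states that is closed under satisfaction of the same formulas is definable. -/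
theorem exists_sumSat_iff [Finite M.carrier] [Finite N.carrier] (s : Set (M.carrier ⊕ N.carrier))
    (hs : ∀ a b, (∀ φ, SumSat M N a φ ↔ SumSat M N b φ) → a ∈ s → b ∈ s) :
    ∃ φ, ∀ a, SumSat M N a φ ↔ a ∈ s := by
  classical
  have := Fintype.ofFinite M.carrier
  have := Fintype.ofFinite N.carrier
  have hsep : ∀ a b, ∃ φ, a ∈ s → b ∉ s → SumSat M N a φ ∧ ¬ SumSat M N b φ := by
    intro a b
    by_cases h : a ∈ s ∧ b ∉ s
    · have : ¬ ∀ φ, SumSat M N a φ ↔ SumSat M N b φ := fun hab => h.2 (hs a b hab h.1)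
      obtain ⟨φ, hφ⟩ := not_forall.1 this
      by_cases ha : SumSat M N a φ
      · exact ⟨φ, fun _ _ => ⟨ha, fun hb => hφ ⟨fun _ => hb, fun _ => ha⟩⟩⟩
      · refine ⟨φ.neg, fun _ _ => ⟨(sumSat_neg _ _).2 ha, fun hb => hφ ?_⟩⟩
        exact ⟨fun h => absurd h ha, fun h => absurd h ((sumSat_neg _ _).1 hb)⟩
    · exact ⟨.top, fun ha hb => absurd ⟨ha, hb⟩ h⟩
  choose g hg using hsep
  -- For `a` in `s`, `h a` is true at `a` and false at every state outside `s`. The final formula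
  -- is, up to negations, the disjunction of these `h a`.
  choose h hh using fun a => exists_sumSat_iff_forall (M := M) (N := N)
    (Finset.univ.filter (· ∉ s)) (g a)
  obtain ⟨φ, hφ⟩ := exists_sumSat_iff_forall (M := M) (N := N)
    (Finset.univ.filter (· ∈ s)) (fun a => (h a).neg)
  refine ⟨φ.neg, fun b => ?_⟩
  rw [sumSat_neg, hφ]
  simp only [sumSat_neg, hh, Finset.mem_filter, Finset.mem_univ, true_and]
  constructor
  · intro hb
    by_contra hbs
    exact hb fun a ha hall => (hg a b ha hbs).2 (hall b hbs)
  · intro hb hall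
    exact hall b hb fun c hc => (hg b c hb hc).1

theorem Invariant.exists_iff_eq [Finite M.carrier] [Finite N.carrier] {f : M.carrier → ℕ}
    {g : N.carrier → ℕ} (h : Invariant M N f g) (n : ℕ) :
    ∃ φ, (∀ x, Sat M x φ ↔ f x = n) ∧ ∀ y, Sat N y φ ↔ g y = n := by
  obtain ⟨φ, hφ⟩ := exists_sumSat_iff (M := M) (N := N) {a | Sum.elim f g a = n}
    fun a b hab ha => (h a b hab).symm.trans ha
  exact ⟨φ, fun x => hφ (.inl x), fun y => hφ (.inr y)⟩

end

/-- Each cardinality, if positive, is itself a threshold to test. Threshold zero carries no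
information, which matches graded diamonds starting at 1. -/
theorem encard_eq_of_forall_pos_le {X : Type w₁} {Y : Type w₂} [Finite X] [Finite Y]
    {s : Set X} {t : Set Y}
    (h : ∀ k : ℕ+, ((k : ℕ) : ℕ∞) ≤ s.encard ↔ ((k : ℕ) : ℕ∞) ≤ t.encard) :
    s.ncard = t.ncard := by
  rw [← s.toFinite.cast_ncard_eq, ← t.toFinite.cast_ncard_eq] at h
  simp only [Nat.cast_le] at h
  apply le_antisymm
  · rcases Nat.eq_zero_or_pos s.ncard with h0 | h0
    · omega
    · exact (h ⟨_, h0⟩).1 le_rfl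
  · rcases Nat.eq_zero_or_pos t.ncard with h0 | h0
    · omega
    · exact (h ⟨_, h0⟩).2 le_rfl

theorem sum_eq_sum_of_card_fiber_eq {X : Type w₁} {Y : Type w₂} {s : Finset X} {t : Finset Y}
    {f : X → ℕ} {g : Y → ℕ}
    (h : ∀ n, (s.filter (f · = n)).card = (t.filter (g · = n)).card) :
    ∑ x ∈ s, f x = ∑ y ∈ t, g y := by
  have : s.val.map f = t.val.map g := by
    ext n
    have := h n
    simp only [Finset.card_def, Finset.filter_val] at this
    simpa only [Multiset.count_map, eq_comm] using this
  exact congrArg Multiset.sum this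

/-- The sum depends only on how many successors take each value `n`, and graded diamonds over a
formula defining that level set fix this number. `A` and `B` are arbitrary so that two states of the
same system can also be compared. -/
theorem succSum_eq_succSum {A : LTS.{u, v, w₁} P I} {B : LTS.{u, v, w₂} P I} [Fintype A.carrier]
    [Fintype B.carrier] {f : A.carrier → ℕ} {g : B.carrier → ℕ}
    (h : ∀ n, ∃ φ, (∀ x, Sat A x φ ↔ f x = n) ∧ ∀ y, Sat B y φ ↔ g y = n) (i : I)
    {x : A.carrier} {y : B.carrier} (hxy : ∀ φ, Sat A x φ ↔ Sat B y φ) :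
    LTS.succSum (A.rel i) f x = LTS.succSum (B.rel i) g y := by
  classical
  have : ∑ z ∈ Finset.univ.filter (A.rel i x), f z = ∑ z ∈ Finset.univ.filter (B.rel i y), g z := by
    refine sum_eq_sum_of_card_fiber_eq fun n => ?_
    obtain ⟨φ, hA, hB⟩ := h n
    have key : {z | A.rel i x z ∧ f z = n}.ncard = {z | B.rel i y z ∧ g z = n}.ncard := by
      refine encard_eq_of_forall_pos_le fun k => ?_
      have := hxy (.gradedDia i k φ)
      simpa only [Sat, hA, hB] using this
    rw [Finset.filter_filter, Finset.filter_filter, ← Set.ncard_coe_finset, ← Set.ncard_coe_finset]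
    simpa using key
  rw [Finset.sum_filter, Finset.sum_filter] at this
  unfold LTS.succSum
  convert this

theorem sum_eq_sum_of_equivalent {A : LTS.{u, v, w₁} P I} {B : LTS.{u, v, w₂} P I}
    [Fintype A.carrier] [Fintype B.carrier] {f : A.carrier → ℕ} {g : B.carrier → ℕ}
    (h : ∀ n, ∃ φ, (∀ x, Sat A x φ ↔ f x = n) ∧ ∀ y, Sat B y φ ↔ g y = n)
    (hAB : Equivalent A B) : ∑ x, f x = ∑ y, g y := by
  refine sum_eq_sum_of_card_fiber_eq fun n => ?_
  obtain ⟨φ, hA, hB⟩ := h n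
  have key : {z | f z = n}.ncard = {z | g z = n}.ncard := by
    refine encard_eq_of_forall_pos_le fun k => ?_
    have := hAB (.global k φ)
    simpa only [Sat, hA, hB] using this
  rw [← Set.ncard_coe_finset, ← Set.ncard_coe_finset]
  simpa using key

section

variable {M : LTS.{u, v, w₁} P I} {N : LTS.{u, v, w₂} P I} [Fintype M.carrier] [Fintype N.carrier]

theorem Invariant.succSum {f : M.carrier → ℕ} {g : N.carrier → ℕ} (h : Invariant M N f g) (i : I) :
    Invariant M N (LTS.succSum (M.rel i) f) (LTS.succSum (N.rel i) g) := by
  have hM : ∀ n, ∃ φ, (∀ x, Sat M x φ ↔ f x = n) ∧ ∀ x, Sat M x φ ↔ f x = n := fun n =>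
    let ⟨φ, hφ⟩ := h.exists_iff_eq n; ⟨φ, hφ.1, hφ.1⟩
  have hN : ∀ n, ∃ φ, (∀ x, Sat N x φ ↔ g x = n) ∧ ∀ x, Sat N x φ ↔ g x = n := fun n =>
    let ⟨φ, hφ⟩ := h.exists_iff_eq n; ⟨φ, hφ.2, hφ.2⟩
  rintro (x | x) (y | y) hxy
  · exact succSum_eq_succSum hM i hxy
  · exact succSum_eq_succSum h.exists_iff_eq i hxy
  · exact (succSum_eq_succSum h.exists_iff_eq i fun φ => (hxy φ).symm).symm
  · exact succSum_eq_succSum hN i hxy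

theorem LTS.IsTree.invariant_card_hom {T : LTS.{u, v, t} P I} [Finite T.carrier] (hT : T.IsTree) :
    Invariant M N (fun x => Nat.card (T.Hom (M.at' x))) (fun y => Nat.card (T.Hom (N.at' y))) := by
  refine hT.card_hom_induction M N (Invariant M N) ?_ ?_ ?_ fun i f g h => h.succSum i
  · classical
    intro m a b hab
    have hp (p : P) := hab (.letter p)
    rcases a with a | a <;> rcases b with b | b <;>
      exact if_congr (forall_congr' fun p => imp_congr_right fun _ => hp p) rfl rfl
  · rintro (a | a) (b | b) _ <;> rfl
  · intro f g f' g' h h' a b hab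
    have h1 := h a b hab
    have h2 := h' a b hab
    rcases a with a | a <;> rcases b with b | b <;> exact congrArg₂ (· * ·) h1 h2

theorem leftProfile_eq_of_equivalent (h : Equivalent M N) :
    LTS.leftProfile ℕ (finiteForests.{u, v, t} P I) M =
      LTS.leftProfile ℕ (finiteForests.{u, v, t} P I) N := by
  classical
  funext ⟨T, hfin, J, hJ, F, j₀, hF, hiso⟩
  have := Fintype.ofFinite J
  have hfinF (j : J) : Finite (F j).carrier := by
    obtain ⟨e, -⟩ := hiso
    have : Finite (Σ j, (F j).carrier) := Finite.of_equiv _ e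
    exact Finite.of_injective (fun x : (F j).carrier => (⟨j, x⟩ : Σ j, (F j).carrier))
      fun x y hxy => eq_of_heq (Sigma.mk.inj hxy).2
  simp only [LTS.leftProfile, LTS.homCount, Nat.cast_id]
  rw [LTS.homCount_congr_of_isIso hiso, LTS.homCount_congr_of_isIso hiso,
    LTS.card_hom_disjointUnion, LTS.card_hom_disjointUnion]
  congr 1
  -- `M.at' M.pt` is definitionally `M`.
  · exact (hF j₀).invariant_card_hom (M := M) (N := N) (.inl M.pt) (.inr N.pt) h
  · exact Finset.prod_congr rfl fun j _ =>
      sum_eq_sum_of_equivalent (hF j).invariant_card_hom.exists_iff_eq h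

end

/-! ### Building trees and counting their homomorphisms -/

namespace LTS

/-- The tree with one state and no facts. -/
def point : LTS.{u, v, t} P I where
  carrier := PUnit
  prop _ _ := False
  rel _ _ _ := False
  pt := ⟨⟩

/-- `T` with the letter `p` added at the distinguished state. -/
def addLetter (T : LTS.{u, v, t} P I) (p : P) : LTS.{u, v, t} P I where
  carrier := T.carrier
  prop q x := T.prop q x ∨ q = p ∧ x = T.pt
  rel := T.rel
  pt := T.pt

/-- The disjoint union of `S` and `T` with an `i`-fact added from the distinguished state of `T`,
which stays distinguished, to that of `S`. -/
def graft (i : I) (S T : LTS.{u, v, t} P I) : LTS.{u, v, t} P I where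
  carrier := S.carrier ⊕ T.carrier
  prop p := Sum.elim (S.prop p) (T.prop p)
  rel j
    | .inl x, .inl y => S.rel j x y
    | .inr x, .inr y => T.rel j x y
    | .inr x, .inl y => j = i ∧ x = T.pt ∧ y = S.pt
    | .inl _, .inr _ => False
  pt := .inr T.pt

theorem isTree_point : (point : LTS.{u, v, t} P I).IsTree :=
  IsRankedTree.isTree (d := fun _ => 0)
    { rank_rel := fun _ _ _ h => h.elim
      not_rel_pt := fun _ _ h => h
      exists_rel := fun _ h => absurd rfl h
      rel_unique := fun _ _ _ _ _ h => h.elim }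

theorem IsTree.addLetter {T : LTS.{u, v, t} P I} (hT : T.IsTree) (p : P) :
    (T.addLetter p).IsTree := by
  obtain ⟨d, hd⟩ := hT.exists_isRankedTree
  exact IsRankedTree.isTree (d := d) ⟨hd.rank_rel, hd.not_rel_pt, hd.exists_rel, hd.rel_unique⟩

theorem IsTree.graft {S T : LTS.{u, v, t} P I} (hS : S.IsTree) (hT : T.IsTree) (i : I) :
    (graft i S T).IsTree := by
  obtain ⟨d, hd⟩ := hS.exists_isRankedTree
  obtain ⟨e, he⟩ := hT.exists_isRankedTree
  refine IsRankedTree.isTree (M := LTS.graft i S T)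
    (d := Sum.elim (fun x => d x + e T.pt + 1 - d S.pt) e) ?_
  -- The root of `S` has least rank, so the natural subtraction in the shifted rank never truncates.
  have hle : ∀ n x, d x = n → d S.pt ≤ d x := by
    intro n
    induction n with
    | zero =>
      intro x hx
      by_cases h : x = S.pt
      · rw [h]
      · obtain ⟨j, y, hy⟩ := hd.exists_rel x h
        have := hd.rank_rel _ _ _ hy
        omega
    | succ n ih =>
      intro x hx
      by_cases h : x = S.pt
      · rw [h]
      · obtain ⟨j, y, hy⟩ := hd.exists_rel x h
        have := hd.rank_rel _ _ _ hy
        have := ih y (by omega)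
        omega
  constructor
  · rintro j (x | x) (y | y) h
    · have := hd.rank_rel j x y h
      have := hle _ x rfl
      simp only [Sum.elim_inl]
      omega
    · exact h.elim
    · obtain ⟨-, rfl, rfl⟩ := h
      simp only [Sum.elim_inl, Sum.elim_inr]
      omega
    · exact he.rank_rel j x y h
  · rintro j (x | x) h
    · exact h
    · exact he.not_rel_pt j x h
  · rintro (y | y) hy
    · by_cases h : y = S.pt
      · exact ⟨i, .inr T.pt, rfl, rfl, h⟩
      · obtain ⟨j, x, hx⟩ := hd.exists_rel y h
        exact ⟨j, .inl x, hx⟩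
    · obtain ⟨j, x, hx⟩ := he.exists_rel y fun h => hy (congrArg Sum.inr h)
      exact ⟨j, .inr x, hx⟩
  · rintro j k (x | x) (x' | x') (y | y) h h'
    · obtain ⟨rfl, rfl⟩ := hd.rel_unique _ _ _ _ _ h h'
      exact ⟨rfl, rfl⟩
    · exact h.elim
    · obtain ⟨rfl, rfl, rfl⟩ := h'
      exact absurd h (hd.not_rel_pt _ _)
    · exact h.elim
    · obtain ⟨rfl, rfl, rfl⟩ := h
      exact absurd h' (hd.not_rel_pt _ _)
    · exact h'.elim
    · obtain ⟨rfl, rfl, rfl⟩ := h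
      obtain ⟨rfl, rfl, -⟩ := h'
      exact ⟨rfl, rfl⟩
    · obtain ⟨rfl, rfl⟩ := he.rel_unique _ _ _ _ _ h h'
      exact ⟨rfl, rfl⟩

theorem card_hom_point (M : LTS.{u, v, w} P I) :
    Nat.card ((point : LTS.{u, v, t} P I).Hom M) = 1 := by
  rw [Nat.card_eq_one_iff_unique]
  exact ⟨⟨fun f g => Subtype.ext (funext fun _ => f.2.map_pt.trans g.2.map_pt.symm)⟩,
    ⟨fun _ => M.pt, rfl, fun _ _ h => h.elim, fun _ _ _ h => h.elim⟩⟩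

open Classical in
theorem card_hom_addLetter (T : LTS.{u, v, t} P I) (p : P) (M : LTS.{u, v, w} P I) :
    Nat.card ((T.addLetter p).Hom M) = (if M.prop p M.pt then 1 else 0) * Nat.card (T.Hom M) := by
  by_cases h : M.prop p M.pt
  · rw [if_pos h, one_mul]
    refine Nat.card_congr (Equiv.subtypeEquivRight fun f => ⟨fun hf => ?_, fun hf => ?_⟩)
    · exact ⟨hf.map_pt, fun q x hx => hf.map_prop q x (.inl hx), hf.map_rel⟩
    · refine ⟨hf.map_pt, fun q x hx => ?_, hf.map_rel⟩
      rcases hx with hx | ⟨rfl, rfl⟩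
      · exact hf.map_prop q x hx
      · rwa [hf.map_pt]
  · rw [if_neg h, zero_mul]
    have : IsEmpty ((T.addLetter p).Hom M) := ⟨fun f => h (by
      have := f.2.map_prop p T.pt (.inr ⟨rfl, rfl⟩)
      rwa [show f.1 T.pt = M.pt from f.2.map_pt] at this)⟩
    exact Nat.card_of_isEmpty

theorem sigma_subtype_hom_at'_ext {S : LTS.{u, v, w₁} P I} {M : LTS.{u, v, w} P I}
    {p : M.carrier → Prop} {g h : Σ y : {y // p y}, S.Hom (M.at' y)} (hgh : g.2.1 = h.2.1) :
    g = h := by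
  obtain ⟨⟨y, hy⟩, k, hk⟩ := g
  obtain ⟨⟨z, hz⟩, l, hl⟩ := h
  obtain rfl : k = l := hgh
  obtain rfl : y = z := hk.map_pt.symm.trans hl.map_pt
  rfl

/-- A homomorphism from a graft is a pair of homomorphisms, the first one sending the
distinguished state to a successor of the distinguished state. -/
def graftHomEquiv (i : I) (S T : LTS.{u, v, t} P I) (M : LTS.{u, v, w} P I) :
    (graft i S T).Hom M ≃
      (Σ y : {y // M.rel i M.pt y}, S.Hom (M.at' y)) × T.Hom M where
  toFun f :=
    ⟨⟨⟨f.1 (.inl S.pt), by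
        have := f.2.map_rel i (.inr T.pt) (.inl S.pt) ⟨rfl, rfl, rfl⟩
        rwa [show f.1 (.inr T.pt) = M.pt from f.2.map_pt] at this⟩,
      ⟨fun x => f.1 (.inl x), rfl, fun p x => f.2.map_prop p (.inl x),
        fun j x y => f.2.map_rel j (.inl x) (.inl y)⟩⟩,
      ⟨fun x => f.1 (.inr x), f.2.map_pt, fun p x => f.2.map_prop p (.inr x),
        fun j x y => f.2.map_rel j (.inr x) (.inr y)⟩⟩
  invFun g := ⟨Sum.elim g.1.2.1 g.2.1, g.2.2.map_pt, by
      rintro p (x | x) hx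
      · exact g.1.2.2.map_prop p x hx
      · exact g.2.2.map_prop p x hx, by
      rintro j (x | x) (y | y) h
      · exact g.1.2.2.map_rel j x y h
      · exact h.elim
      · obtain ⟨rfl, rfl, rfl⟩ := h
        have h1 : g.2.1 T.pt = M.pt := g.2.2.map_pt
        have h2 : g.1.2.1 S.pt = g.1.1.1 := g.1.2.2.map_pt
        change M.rel _ (g.2.1 T.pt) (g.1.2.1 S.pt)
        rw [h1, h2]
        exact g.1.1.2
      · exact g.2.2.map_rel j x y h⟩
  left_inv f := Subtype.ext (funext fun x => by rcases x with x | x <;> rfl)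
  right_inv _ := Prod.ext (sigma_subtype_hom_at'_ext rfl) rfl

theorem card_hom_graft (i : I) (S T : LTS.{u, v, t} P I) [Finite S.carrier]
    (M : LTS.{u, v, w} P I) [Fintype M.carrier] :
    Nat.card ((graft i S T).Hom M) =
      succSum (M.rel i) (fun y => Nat.card (S.Hom (M.at' y))) M.pt * Nat.card (T.Hom M) := by
  classical
  have (y : M.carrier) : Finite (M.at' y).carrier := inferInstanceAs (Finite M.carrier)
  rw [Nat.card_congr (graftHomEquiv i S T M), Nat.card_prod, Nat.card_sigma]
  congr 1
  rw [← Finset.sum_subtype (Finset.univ.filter (M.rel i M.pt)) (by simp)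
    fun y => Nat.card (S.Hom (M.at' y)), Finset.sum_filter]
  unfold succSum
  convert rfl

end LTS

/-! ### Functions realised by tree counts -/

/-- The pairs of functions, on the states of two systems, that count homomorphisms from some
finite tree. -/
def TreeCount (M : LTS.{u, v, w₁} P I) (N : LTS.{u, v, w₂} P I) (f : M.carrier → ℕ)
    (g : N.carrier → ℕ) : Prop :=
  ∃ T : LTS.{u, v, t} P I, Finite T.carrier ∧ T.IsTree ∧
    (∀ x, f x = Nat.card (T.Hom (M.at' x))) ∧ ∀ y, g y = Nat.card (T.Hom (N.at' y))

open Classical in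
/-- The pairs of functions obtained from the constant `1` by multiplying with indicators of
letters and with successor sums. -/
inductive TreeFun (M : LTS.{u, v, w₁} P I) (N : LTS.{u, v, w₂} P I) [Fintype M.carrier]
    [Fintype N.carrier] : (M.carrier → ℕ) → (N.carrier → ℕ) → Prop
  | one : TreeFun M N 1 1
  | letter (p : P) {f g} : TreeFun M N f g →
      TreeFun M N ((fun x => if M.prop p x then 1 else 0) * f)
        ((fun y => if N.prop p y then 1 else 0) * g)
  | succ (i : I) {f g f' g'} : TreeFun M N f g → TreeFun M N f' g' →
      TreeFun M N (LTS.succSum (M.rel i) f * f') (LTS.succSum (N.rel i) g * g')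

section

variable {M : LTS.{u, v, w₁} P I} {N : LTS.{u, v, w₂} P I} [Fintype M.carrier] [Fintype N.carrier]

theorem TreeFun.treeCount {f : M.carrier → ℕ} {g : N.carrier → ℕ} (h : TreeFun M N f g) :
    TreeCount.{u, v, w₁, w₂, t} M N f g := by
  induction h with
  | one => exact ⟨LTS.point, inferInstanceAs (Finite PUnit), LTS.isTree_point,
      fun x => (LTS.card_hom_point _).symm, fun x => (LTS.card_hom_point _).symm⟩
  | letter p _ ih =>
    obtain ⟨T, hfin, hT, hf, hg⟩ := ih
    refine ⟨T.addLetter p, hfin, hT.addLetter p, fun x => ?_, fun y => ?_⟩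
    · rw [LTS.card_hom_addLetter, ← hf]; rfl
    · rw [LTS.card_hom_addLetter, ← hg]; rfl
  | @succ i f g f' g' _ _ ih ih' =>
    obtain ⟨S, _, hS, hf, hg⟩ := ih
    obtain ⟨T, _, hT, hf', hg'⟩ := ih'
    refine ⟨LTS.graft i S T, inferInstanceAs (Finite (S.carrier ⊕ T.carrier)), hS.graft hT i,
      fun x => ?_, fun y => ?_⟩
    · let _ : Fintype (M.at' x).carrier := inferInstanceAs (Fintype M.carrier)
      rw [Pi.mul_apply, hf', show f = fun x => _ from funext hf]
      exact (LTS.card_hom_graft i S T (M.at' x)).symm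
    · let _ : Fintype (N.at' y).carrier := inferInstanceAs (Fintype N.carrier)
      rw [Pi.mul_apply, hg', show g = fun x => _ from funext hg]
      exact (LTS.card_hom_graft i S T (N.at' y)).symm

/-- This is the gluing of two trees at their roots. The extra factor in the `succ` constructor
reduces it to associativity. -/
theorem TreeFun.mul {f f' : M.carrier → ℕ} {g g' : N.carrier → ℕ} (h : TreeFun M N f g)
    (h' : TreeFun M N f' g') : TreeFun M N (f * f') (g * g') := by
  induction h with
  | one => simpa using h'
  | letter p _ ih => simpa only [mul_assoc] using ih.letter p
  | succ i h _ _ ih => simpa only [mul_assoc] using h.succ i ih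

end

theorem card_hom_disjointUnion_eq {M : LTS.{u, v, w₁} P I} {N : LTS.{u, v, w₂} P I} {J : Type} [Finite J]
    {F : J → LTS.{u, v, t} P I}
    (hfin : ∀ j, Finite (F j).carrier) (hF : ∀ j, (F j).IsTree) (j₀ : J)
    (h : LTS.leftProfile ℕ (finiteForests.{u, v, t} P I) M =
      LTS.leftProfile ℕ (finiteForests.{u, v, t} P I) N) :
    Nat.card ((LTS.disjointUnion F j₀).Hom M) = Nat.card ((LTS.disjointUnion F j₀).Hom N) := by
  have hT : LTS.disjointUnion F j₀ ∈ finiteForests.{u, v, t} P I :=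
    ⟨inferInstanceAs (Finite (Σ j, (F j).carrier)), J, inferInstance, F, j₀, hF, Equiv.refl _,
      ⟨rfl, fun _ _ h => h, fun _ _ _ h => h⟩, ⟨rfl, fun _ _ h => h, fun _ _ _ h => h⟩⟩
  exact congrFun h ⟨_, hT⟩

/-! ### The rational span of tree counts, and equivalence from equal counts -/

section

variable (M : LTS.{u, v, w₁} P I) (N : LTS.{u, v, w₂} P I) [Fintype M.carrier] [Fintype N.carrier]

/-- The rational span of the functions counting homomorphisms from finite trees. -/
def treeSpan : Submodule ℚ (M.carrier ⊕ N.carrier → ℚ) :=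
  Submodule.span ℚ {h | ∃ f g, TreeFun M N f g ∧ h = fun a => ((Sum.elim f g a : ℕ) : ℚ)}

open Classical in
/-- The sum over the `R i`-successors, for functions on the states of two systems. -/
noncomputable def sumSucc (i : I) (h : M.carrier ⊕ N.carrier → ℚ) : M.carrier ⊕ N.carrier → ℚ :=
  Sum.elim (fun x => ∑ y, if M.rel i x y then h (.inl y) else 0)
    (fun x => ∑ y, if N.rel i x y then h (.inr y) else 0)

open Classical in
/-- The indicator function of the states satisfying `φ`. -/
noncomputable def truthInd (φ : Formula P I) (a : M.carrier ⊕ N.carrier) : ℚ :=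
  if SumSat M N a φ then 1 else 0

variable {M N}

theorem TreeFun.mem_treeSpan {f : M.carrier → ℕ} {g : N.carrier → ℕ} (h : TreeFun M N f g) :
    (fun a => ((Sum.elim f g a : ℕ) : ℚ)) ∈ treeSpan M N :=
  Submodule.subset_span ⟨f, g, h, rfl⟩

theorem one_mem_treeSpan : (1 : M.carrier ⊕ N.carrier → ℚ) ∈ treeSpan M N := by
  convert (TreeFun.one (M := M) (N := N)).mem_treeSpan using 1
  funext a
  rcases a with a | a <;> simp

theorem mul_mem_treeSpan {h k : M.carrier ⊕ N.carrier → ℚ} (hh : h ∈ treeSpan M N)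
    (hk : k ∈ treeSpan M N) : h * k ∈ treeSpan M N := by
  have hle : treeSpan M N * treeSpan M N ≤ treeSpan M N := by
    rw [treeSpan, Submodule.span_mul_span]
    refine Submodule.span_le.2 ?_
    rintro _ ⟨_, ⟨f, g, hfg, rfl⟩, _, ⟨f', g', hfg', rfl⟩, rfl⟩
    have hmul : (fun a => ((Sum.elim f g a : ℕ) : ℚ)) * (fun a => ((Sum.elim f' g' a : ℕ) : ℚ)) =
        fun a => ((Sum.elim (f * f') (g * g') a : ℕ) : ℚ) := by
      funext a
      rcases a with a | a <;> simp
    exact Submodule.subset_span ⟨_, _, hfg.mul hfg', hmul⟩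
  exact hle (Submodule.mul_mem_mul hh hk)

/-- The operation is linear and maps generators to generators, by `TreeFun.succ` with second factor
1. -/
theorem sumSucc_mem_treeSpan (i : I) {h : M.carrier ⊕ N.carrier → ℚ} (hh : h ∈ treeSpan M N) :
    sumSucc M N i h ∈ treeSpan M N := by
  induction hh using Submodule.span_induction with
  | mem _ h =>
    obtain ⟨f, g, hfg, rfl⟩ := h
    convert (hfg.succ i .one).mem_treeSpan using 1
    funext a
    rcases a with a | a <;> simp [sumSucc, LTS.succSum]
  | zero =>
    convert (treeSpan M N).zero_mem using 1
    funext a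
    rcases a with a | a <;> simp [sumSucc]
  | add h k _ _ hh hk =>
    convert (treeSpan M N).add_mem hh hk using 1
    funext a
    rcases a with a | a <;> simp [sumSucc, ← Finset.sum_add_distrib, ← ite_add_zero]
  | smul c h _ hh =>
    convert (treeSpan M N).smul_mem c hh using 1
    funext a
    rcases a with a | a <;> simp [sumSucc, Finset.mul_sum]

open Classical in
/-- The span is closed under composition with arbitrary functions, by interpolation. -/
theorem comp_mem_treeSpan {h : M.carrier ⊕ N.carrier → ℚ} (hh : h ∈ treeSpan M N) (s : ℚ → ℚ) :
    s ∘ h ∈ treeSpan M N := by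
  let A : Subalgebra ℚ (M.carrier ⊕ N.carrier → ℚ) :=
    (treeSpan M N).toSubalgebra one_mem_treeSpan
      fun _ _ => mul_mem_treeSpan
  let p := Lagrange.interpolate (Finset.univ.image h) id s
  have hp : Polynomial.aeval h p = s ∘ h := by
    funext a
    -- Evaluation at `a` is an algebra homomorphism, so `p` applied to `h` has value p(h(a)) =
    -- s(h(a)) there.
    have h1 := Polynomial.aeval_algHom_apply (Pi.evalAlgHom ℚ (fun _ => ℚ) a) h p
    have h2 := Lagrange.eval_interpolate_at_node (s := Finset.univ.image h) (v := id) s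
      (Set.injOn_id _) (Finset.mem_image_of_mem h (Finset.mem_univ a))
    rw [Pi.evalAlgHom_apply, Pi.evalAlgHom_apply, Polynomial.coe_aeval_eq_eval] at h1
    exact h1.symm.trans h2
  have : Polynomial.aeval h p ∈ A :=
    Algebra.adjoin_le (S := A) (Set.singleton_subset_iff.2 hh) (Polynomial.aeval_mem_adjoin_singleton ℚ h)
  rwa [hp] at this

open Classical in
theorem truthInd_mem_of_iff {h : M.carrier ⊕ N.carrier → ℚ} (hh : h ∈ treeSpan M N) (s : ℚ → Prop)
    {φ : Formula P I} (hs : ∀ a, SumSat M N a φ ↔ s (h a)) : truthInd M N φ ∈ treeSpan M N := by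
  convert comp_mem_treeSpan hh (fun q => if s q then 1 else 0) using 1
  funext a
  exact if_congr (hs a) rfl rfl

theorem natCast_le_encard_iff {X : Type w} [Finite X] (s : Set X) (k : ℕ) :
    (k : ℕ∞) ≤ s.encard ↔ (k : ℚ) ≤ (s.ncard : ℚ) := by
  rw [← s.toFinite.cast_ncard_eq, Nat.cast_le, Nat.cast_le]

open Classical in
theorem sum_ite_ite_eq_ncard {X : Type w} [Fintype X] (p q : X → Prop) :
    (∑ x, if p x then (if q x then (1 : ℚ) else 0) else 0) = ({x | p x ∧ q x}.ncard : ℚ) := by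
  have : {x | p x ∧ q x} = ((Finset.univ.filter fun x => p x ∧ q x : Finset X) : Set X) := by
    ext; simp
  rw [this, Set.ncard_coe_finset]
  simp [Finset.sum_ite, Finset.filter_filter]

theorem sumSucc_truthInd_inl (i : I) (φ : Formula P I) (x : M.carrier) :
    sumSucc M N i (truthInd M N φ) (.inl x) = ({y | M.rel i x y ∧ Sat M y φ}.ncard : ℚ) :=
  sum_ite_ite_eq_ncard _ _

theorem sumSucc_truthInd_inr (i : I) (φ : Formula P I) (x : N.carrier) :
    sumSucc M N i (truthInd M N φ) (.inr x) = ({y | N.rel i x y ∧ Sat N y φ}.ncard : ℚ) :=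
  sum_ite_ite_eq_ncard _ _

/-- Each connective is a condition on the value of a function already in the span. The hypothesis
`hsum` is used only for the global modality. -/
theorem truthInd_mem_treeSpan
    (hsum : ∀ h ∈ treeSpan M N, ∑ x, h (.inl x) = ∑ y, h (.inr y)) (φ : Formula P I) :
    truthInd M N φ ∈ treeSpan M N := by
  classical
  have hdia (i : I) (k : ℕ) (φ ψ : Formula P I) (h : truthInd M N φ ∈ treeSpan M N)
      (hM : ∀ x, Sat M x ψ ↔ (k : ℕ∞) ≤ {y | M.rel i x y ∧ Sat M y φ}.encard)
      (hN : ∀ x, Sat N x ψ ↔ (k : ℕ∞) ≤ {y | N.rel i x y ∧ Sat N y φ}.encard) :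
      truthInd M N ψ ∈ treeSpan M N := by
    refine truthInd_mem_of_iff (sumSucc_mem_treeSpan i h) (fun q => (k : ℚ) ≤ q) ?_
    rintro (x | x)
    · rw [sumSucc_truthInd_inl, ← natCast_le_encard_iff]; exact hM x
    · rw [sumSucc_truthInd_inr, ← natCast_le_encard_iff]; exact hN x
  have hneg (φ ψ : Formula P I) (h : truthInd M N φ ∈ treeSpan M N)
      (hψ : ∀ a, SumSat M N a ψ ↔ ¬ SumSat M N a φ) : truthInd M N ψ ∈ treeSpan M N := by
    refine truthInd_mem_of_iff h (fun q => q = 0) fun a => ?_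
    rw [hψ]
    simp [truthInd]
  induction φ with
  | top => exact truthInd_mem_of_iff one_mem_treeSpan (fun _ => True) fun a => by simp [sumSat_top]
  | letter p =>
    refine truthInd_mem_of_iff (TreeFun.one.letter p).mem_treeSpan (fun q => q = 1) ?_
    rintro (x | x) <;> simp [SumSat, Sat]
  | and φ ψ h h' =>
    refine truthInd_mem_of_iff (mul_mem_treeSpan h h') (fun q => q = 1) fun a => ?_
    by_cases h1 : SumSat M N a φ <;> by_cases h2 : SumSat M N a ψ <;>
      simp [truthInd, sumSat_and, h1, h2]
  | or φ ψ h h' =>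
    refine truthInd_mem_of_iff ((treeSpan M N).add_mem h h') (fun q => 1 ≤ q) fun a => ?_
    have : SumSat M N a (φ.or ψ) ↔ SumSat M N a φ ∨ SumSat M N a ψ := by cases a <;> rfl
    rw [this]
    by_cases h1 : SumSat M N a φ <;> by_cases h2 : SumSat M N a ψ <;>
      simp [truthInd, h1, h2]
  | neg φ h => exact hneg φ _ h fun a => sumSat_neg a φ
  | dia i φ h =>
    refine hdia i 1 φ _ h (fun x => ?_) fun x => ?_ <;>
      rw [Nat.cast_one, Set.one_le_encard_iff_nonempty] <;> rfl
  | box i φ h =>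
    have h1 : truthInd M N (.dia i φ.neg) ∈ treeSpan M N := by
      refine hdia i 1 φ.neg _ (hneg φ _ h fun a => sumSat_neg a φ) (fun x => ?_) fun x => ?_ <;>
        rw [Nat.cast_one, Set.one_le_encard_iff_nonempty] <;> rfl
    refine hneg _ _ h1 ?_
    rintro (x | x) <;> simp [SumSat, Sat]
  | gradedDia i k φ h => exact hdia i k φ _ h (fun _ => Iff.rfl) fun _ => Iff.rfl
  | global k φ h =>
    have hM : ∑ x, truthInd M N φ (.inl x) = ({x | Sat M x φ}.ncard : ℚ) := by
      have := sum_ite_ite_eq_ncard (fun _ => True) fun x => Sat M x φ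
      simp only [if_true, true_and] at this
      exact this
    have hN : ∑ x, truthInd M N φ (.inr x) = ({x | Sat N x φ}.ncard : ℚ) := by
      have := sum_ite_ite_eq_ncard (fun _ => True) fun x => Sat N x φ
      simp only [if_true, true_and] at this
      exact this
    -- A global formula has one truth value on all states, so a constant function suffices: the
    -- number of states of `M` satisfying `φ`, which by `hsum` is also the number for `N`.
    refine truthInd_mem_of_iff ((treeSpan M N).smul_mem (∑ x, truthInd M N φ (.inl x))
      one_mem_treeSpan) (fun q => (k : ℚ) ≤ q) ?_
    rintro (x | x)
    · simp only [Pi.smul_apply, Pi.one_apply, smul_eq_mul, mul_one]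
      rw [hM, ← natCast_le_encard_iff]
      rfl
    · simp only [Pi.smul_apply, Pi.one_apply, smul_eq_mul, mul_one]
      rw [hsum _ h, hN, ← natCast_le_encard_iff]
      rfl

theorem equivalent_of_leftProfile_eq
    (h : LTS.leftProfile ℕ (finiteForests.{u, v, t} P I) M =
      LTS.leftProfile ℕ (finiteForests.{u, v, t} P I) N) : Equivalent M N := by
  classical
  have hpt : ∀ k ∈ treeSpan M N, k (.inl M.pt) = k (.inr N.pt) := by
    intro k hk
    induction hk using Submodule.span_induction with
    | mem _ hk =>
      obtain ⟨f, g, hfg, rfl⟩ := hk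
      obtain ⟨T, hfin, hT, hf, hg⟩ := hfg.treeCount.{u, v, w₁, w₂, t}
      have := card_hom_disjointUnion_eq (F := fun _ : Unit => T) (fun _ => hfin) (fun _ => hT) () h
      have hempty : IsEmpty {j : Unit // j ≠ ()} := ⟨fun j => j.2 rfl⟩
      rw [LTS.card_hom_disjointUnion, LTS.card_hom_disjointUnion, Finset.univ_eq_empty,
        Finset.prod_empty, Finset.prod_empty, mul_one, mul_one] at this
      simp only [Sum.elim_inl, Sum.elim_inr, hf, hg]
      exact congrArg _ this
    | zero => rfl
    | add _ _ _ _ h1 h2 => exact congrArg₂ (· + ·) h1 h2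
    | smul c _ _ h1 => exact congrArg (c * ·) h1
  have hsum : ∀ k ∈ treeSpan M N, ∑ x, k (.inl x) = ∑ y, k (.inr y) := by
    intro k hk
    induction hk using Submodule.span_induction with
    | mem _ hk =>
      obtain ⟨f, g, hfg, rfl⟩ := hk
      obtain ⟨T, hfin, hT, hf, hg⟩ := hfg.treeCount.{u, v, w₁, w₂, t}
      -- The distinguished one-point component contributes the factor 1, leaving the sum over all
      -- states of the counts from `T`.
      have := card_hom_disjointUnion_eq (F := fun b : Bool => cond b LTS.point T)
        (by rintro (_ | _); exacts [hfin, inferInstanceAs (Finite PUnit)])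
        (by rintro (_ | _); exacts [hT, LTS.isTree_point]) true h
      have hfin' (b : Bool) : Finite (cond b LTS.point T).carrier := by
        cases b; exacts [hfin, inferInstanceAs (Finite PUnit)]
      let _ : Unique {b : Bool // b ≠ true} :=
        ⟨⟨⟨false, by simp⟩⟩, fun b => Subtype.ext (by simpa using b.2)⟩
      rw [LTS.card_hom_disjointUnion, LTS.card_hom_disjointUnion, cond_true,
        LTS.card_hom_point, LTS.card_hom_point, one_mul, one_mul,
        Fintype.prod_unique, Fintype.prod_unique] at this
      simp only [Sum.elim_inl, Sum.elim_inr, hf, hg]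
      exact_mod_cast this
    | zero => simp
    | add _ _ _ _ h1 h2 => simp only [Pi.add_apply, Finset.sum_add_distrib, h1, h2]
    | smul c _ _ h1 => simp only [Pi.smul_apply, ← Finset.smul_sum, h1]
  intro φ
  have := hpt _ (truthInd_mem_treeSpan hsum φ)
  by_cases h1 : Sat M M.pt φ <;> by_cases h2 : Sat N N.pt φ <;>
    simp_all [truthInd, SumSat]

end
end ModalHom

theorem mainTheorem6 {P : Type u} {I : Type v} [Finite P] [Finite I]
    (M : ModalHom.LTS.{u, v, w₁} P I) (N : ModalHom.LTS.{u, v, w₂} P I)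
    [Finite M.carrier] [Finite N.carrier] :
    ModalHom.Equivalent M N ↔
      ModalHom.LTS.leftProfile ℕ (ModalHom.finiteForests.{u, v, t} P I) M =
        ModalHom.LTS.leftProfile ℕ (ModalHom.finiteForests.{u, v, t} P I) N := by
  have := Fintype.ofFinite M.carrier
  have := Fintype.ofFinite N.carrier
  exact ⟨ModalHom.leftProfile_eq_of_equivalent, ModalHom.equivalent_of_leftProfile_eq⟩
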